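/- Fix a finite-dimensional quantum system with Hilbert space $\mathbb{C}^{n}$, $n\ge 1$. A channel is a completely positive trace-preserving linear map on the complex $n\times n$ matrices. Let $s(\rho)=-\mathrm{Tr}(\rho\ln\rho)$ be the von Neumann entropy. The Holevo capacity of a channel $\mathcal{N}$ is $$\chi(\mathcal{N})=\sup_{\{p_i,\rho_i\}}\Big\{ s\Big(\sum_i p_i\,\mathcal{N}(\rho_i)\Big)-\sum_i p_i\, s(\mathcal{N}(\rho_i))\Big\},$$ where the supremum (in the extended reals) is over all finite ensembles of density matrices $\rho_i$ with probabilities $p_i$. Let $\Lambda(X)=\mathrm{Tr}(X)\,\mathbb{I}/n$ be the free channel. Given a set $\mathfrak{O}$ of channels (the free operations of the static theory), the set of allowed operations $\mathfrak{O}^{\mathrm{dy}}$ consists of the super-channels $$\Pi(\mathcal{N})=\sum_{\kappa}p_\kappa\,\mathcal{E}_\kappa\circ\mathcal{N}\circ\mathcal{P}_\kappa ,\qquad \mathcal{E}_\kappa,\mathcal{P}_\kappa\in\mathfrak{O},$$ where $\kappa$ ranges over a finite set and $(p_\kappa)$ is a probability distribution. Consider the following two theories. (a) The qubit theory: $n=2$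 and $\mathfrak{O}$ is the set of mixed unitary channels $X\mapsto\sum_i p_i U_iXU_i^\dagger$ (finite sums, $p_i\ge 0$, $\sum_i p_i=1$, $U_i$ unitary). (b) The $n$-dimensional Weyl-covariant theory, for any $n\ge 1$: $\mathfrak{O}$ is the set of channels $\mathcal{N}$ with $\mathcal{N}(W_{ab}XW_{ab}^\dagger)=W_{ab}\,\mathcal{N}(X)\,W_{ab}^\dagger$ for all $X$ and all $a,b\in\{0,\dots,n-1\}$, where $W_{ab}=\sum_{c=0}^{n-1}e^{2\pi i bc/n}\,|c+a \bmod n\rangle\langle c|$. Lemma (the Holevo capacity is a monotone). In each of the theories (a) and (b), $\chi(\Lambda)=0$, and for all $\mathcal{M},\mathcal{N}\in\mathfrak{O}$, if there is an allowed operation $\Pi\in\mathfrak{O}^{\mathrm{dy}}$ with $\mathcal{M}=\Pi(\mathcal{N})$, then $\chi(\mathcal{M})\le\chi(\mathcal{N})$. -/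

import Mathlib

noncomputable section

/-- Operators on the `n`-dimensional system, as complex `n × n` matrices. -/
abbrev QOp (n : ℕ) : Type := Matrix (Fin n) (Fin n) ℂ

/-- Linear maps on operators of the `n`-dimensional system. -/
abbrev QMap (n : ℕ) : Type := QOp n →ₗ[ℂ] QOp n

open scoped ComplexOrder in
/-- Density matrices: positive semidefinite of unit trace. -/
structure IsDensity {n : ℕ} (ρ : QOp n) : Prop where
  posSemidef : ρ.PosSemidef
  trace_eq_one : ρ.trace = 1

open scoped ComplexOrder MatrixOrder Matrix.Norms.L2Operator CStarAlgebra in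
/-- Quantum channels: completely positive trace-preserving linear maps. Matrices carry the
operator norm and the Loewner order, so that complete positivity is the usual one. -/
structure IsQuantumChannel {n : ℕ} (N : QMap n) : Prop where
  completelyPositive : ∃ f : QOp n →CP QOp n, f.toLinearMap = N
  tracePreserving : ∀ X : QOp n, (N X).trace = X.trace

/-- The von Neumann entropy `s(ρ) = -∑ λ ln λ` over the eigenvalues of `ρ`, with multiplicity
(and the irrelevant value `0` when `ρ` is not Hermitian). -/
def vonNeumannEntropy {n : ℕ} (ρ : QOp n) : ℝ :=
  open scoped Classical in
  if h : ρ.IsHermitian then ∑ i, Real.negMulLog (h.eigenvalues i) else 0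

/-- Finite ensembles `{p i, ρ i}` of states of the `n`-dimensional system. -/
structure QEnsemble (n : ℕ) where
  size : ℕ
  prob : Fin size → ℝ
  state : Fin size → QOp n
  prob_nonneg : ∀ i, 0 ≤ prob i
  prob_sum : ∑ i, prob i = 1
  state_isDensity : ∀ i, IsDensity (state i)

/-- The Holevo quantity of the image of an ensemble:
`s(∑ p i N(ρ i)) - ∑ p i s(N(ρ i))`. -/
def holevoQuantity {n : ℕ} (N : QMap n) (e : QEnsemble n) : ℝ :=
  vonNeumannEntropy (∑ i, (e.prob i : ℂ) • N (e.state i)) -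
    ∑ i, e.prob i * vonNeumannEntropy (N (e.state i))

/-- The Holevo capacity: the supremum of the Holevo quantity over all ensembles, taken in the
extended reals so that it is a genuine supremum. -/
def holevoCapacity {n : ℕ} (N : QMap n) : EReal :=
  ⨆ e : QEnsemble n, (holevoQuantity N e : EReal)

/-- The free channel `Λ(X) = Tr(X) 𝟙 / n`. -/
def freeChannel (n : ℕ) : QMap n where
  toFun X := X.trace • ((n : ℂ)⁻¹ • (1 : QOp n))
  map_add' X Y := by rw [Matrix.trace_add, add_smul]
  map_smul' c X := by rw [Matrix.trace_smul, smul_assoc, RingHom.id_apply]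

/-- Mixed unitary channels `X ↦ ∑ p i U i X (U i)†`, with `p` a probability vector and every
`U i` unitary. -/
def mixedUnitaryChannels (n : ℕ) : Set (QMap n) :=
  {N | ∃ (k : ℕ) (p : Fin k → ℝ) (U : Fin k → QOp n),
    (∀ i, 0 ≤ p i) ∧ ∑ i, p i = 1 ∧ (∀ i, U i ∈ Matrix.unitaryGroup (Fin n) ℂ) ∧
      ∀ X, N X = ∑ i, (p i : ℂ) • (U i * X * (U i).conjTranspose)}

/-- The discrete Weyl operators `W a b = ∑ c, Ω ^ (b c) |c + a mod n⟩⟨c|`, `Ω = exp (2πi / n)`. -/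
def weylOperator {n : ℕ} [NeZero n] (a b : Fin n) : QOp n :=
  Matrix.of fun r c =>
    if r = c + a then Complex.exp (2 * Real.pi * Complex.I / n) ^ (b.val * c.val) else 0

/-- Weyl-covariant channels: channels with `N(W X W†) = W N(X) W†` for every discrete Weyl
operator `W`. -/
def weylCovariantChannels (n : ℕ) [NeZero n] : Set (QMap n) :=
  {N | IsQuantumChannel N ∧ ∀ (a b : Fin n) (X : QOp n),
    N (weylOperator a b * X * (weylOperator a b).conjTranspose) =
      weylOperator a b * N X * (weylOperator a b).conjTranspose}

/-- The allowed operations (super-channels) `Π(N) = ∑ p κ • E κ ∘ N ∘ P κ` of the dynamical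
theory built on a set `F` of free operations of the static theory: pre- and post-processing in
`F`, with shared randomness `p`. -/
def allowedSuperchannels {n : ℕ} (F : Set (QMap n)) : Set (QMap n →ₗ[ℂ] QMap n) :=
  {Pi | ∃ (k : ℕ) (p : Fin k → ℝ) (E P : Fin k → QMap n),
    (∀ i, 0 ≤ p i) ∧ ∑ i, p i = 1 ∧ (∀ i, E i ∈ F) ∧ (∀ i, P i ∈ F) ∧
      ∀ N, Pi N = ∑ i, (p i : ℂ) • (E i ∘ₗ N ∘ₗ P i)}

end

open scoped ComplexOrder

/-! In both theories χ(N) is at least the entropy defect s(𝟙/n) - s(N(σ)) of every output: some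
ensemble containing σ averages to 𝟙/n after N, while none of its outputs has more entropy than N(σ).
For qubits it is {σ, 𝟙 - σ} with equal weights; in the Weyl theory it is the uniform Weyl orbit of
σ. So every output of N has entropy at least s(𝟙/n) - χ(N).

All free operations are positive, trace preserving and unital. Such maps act on spectra by doubly
stochastic matrices, so by concavity of -x ln x neither they nor mixing lowers the average entropy
(`sum_entropy_le_entropy_sum_map`). Hence outputs of Π(N) obey the same lower bound. Since no
average output exceeds s(𝟙/n), every Holevo quantity of Π(N) is at most χ(N)
(`holevoCapacity_superchannel_le`).

Only positivity is required of the maps, because the qubit argument uses tr(X) 𝟙 - X, which is not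
completely positive. -/

/-- Positive, trace-preserving and unital maps. -/
structure IsUnitalPositive {n : ℕ} (N : QMap n) : Prop where
  map_posSemidef : ∀ X : QOp n, X.PosSemidef → (N X).PosSemidef
  map_trace : ∀ X : QOp n, (N X).trace = X.trace
  map_one : N 1 = 1

/-- Positive trace-preserving maps preserve density matrices. -/
lemma IsUnitalPositive.isDensity {n : ℕ} {N : QMap n} (hN : IsUnitalPositive N) {ρ : QOp n}
    (hρ : IsDensity ρ) : IsDensity (N ρ) :=
  ⟨hN.map_posSemidef _ hρ.posSemidef, (hN.map_trace _).trans hρ.trace_eq_one⟩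

/-! ### Entropy under positive unital maps -/

open Matrix in
/-- Resolution of a Hermitian matrix into rank-one projections. -/
lemma Matrix.IsHermitian.exists_spectral_projections {n : ℕ} {σ : QOp n} (hσ : σ.IsHermitian) :
    ∃ G : Fin n → QOp n, (∀ j, (G j).PosSemidef) ∧ (∀ j, (G j).trace = 1) ∧ ∑ j, G j = 1 ∧
      σ = ∑ j, hσ.eigenvalues j • G j := by
  set U : QOp n := hσ.eigenvectorUnitary.1 with hU
  have h1 : U * Uᴴ = 1 := Matrix.mem_unitaryGroup_iff.mp hσ.eigenvectorUnitary.2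
  have h2 : Uᴴ * U = 1 := Matrix.mem_unitaryGroup_iff'.mp hσ.eigenvectorUnitary.2
  refine ⟨fun j => U * Matrix.diagonal (Pi.single j 1) * Uᴴ, fun j => ?_, fun j => ?_, ?_, ?_⟩
  · refine Matrix.PosSemidef.mul_mul_conjTranspose_same (Matrix.PosSemidef.diagonal ?_) _
    exact Pi.single_nonneg.2 zero_le_one
  · rw [Matrix.trace_mul_comm, ← mul_assoc, h2, one_mul, Matrix.trace_diagonal]
    simp
  · rw [← Finset.sum_mul, ← Finset.mul_sum]
    have : ∑ j : Fin n, (Matrix.diagonal (Pi.single j 1) : QOp n) = 1 := by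
      ext r s
      simp [Matrix.sum_apply, Matrix.diagonal_apply, Matrix.one_apply, Pi.single_apply]
    rw [this, mul_one, h1]
  · conv_lhs => rw [hσ.spectral_theorem, Unitary.conjStarAlgAut_apply]
    have : (Matrix.diagonal (RCLike.ofReal ∘ hσ.eigenvalues) : QOp n) =
        ∑ j : Fin n, hσ.eigenvalues j • (Matrix.diagonal (Pi.single j 1) : QOp n) := by
      ext r s
      by_cases h : r = s <;>
      simp [Matrix.sum_apply, Pi.single_apply, h]
    rw [this, Finset.mul_sum, Finset.sum_mul]
    refine Finset.sum_congr rfl fun j _ => ?_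
    rw [Matrix.mul_smul, Matrix.smul_mul]
    rfl

open Matrix in
/-- Diagonal entries in an eigenbasis of a Hermitian matrix, as real linear functionals. -/
lemma Matrix.IsHermitian.exists_eigenbasis_functionals {n : ℕ} {T : QOp n} (hT : T.IsHermitian) :
    ∃ d : Fin n → (QOp n →ₗ[ℝ] ℝ), (∀ i A, A.PosSemidef → 0 ≤ d i A) ∧ (∀ i, d i 1 = 1) ∧
      (∀ A, ∑ i, d i A = A.trace.re) ∧ ∀ i, d i T = hT.eigenvalues i := by
  set U : QOp n := hT.eigenvectorUnitary.1 with hU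
  have h1 : U * Uᴴ = 1 := Matrix.mem_unitaryGroup_iff.mp hT.eigenvectorUnitary.2
  have h2 : Uᴴ * U = 1 := Matrix.mem_unitaryGroup_iff'.mp hT.eigenvectorUnitary.2
  refine ⟨fun i =>
    { toFun := fun A => ((Uᴴ * A * U) i i).re
      map_add' := fun A B => by simp [mul_add, add_mul]
      map_smul' := fun c A => by simp }, fun i A hA => ?_, fun i => ?_, fun A => ?_, fun i => ?_⟩
  · exact (Complex.nonneg_iff.1 ((hA.conjTranspose_mul_mul_same U).diag_nonneg (i := i))).1
  · simp [h2]
  · change ∑ i, ((Uᴴ * A * U) i i).re = _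
    rw [← Complex.re_sum]
    change (Matrix.trace (Uᴴ * A * U)).re = _
    rw [Matrix.trace_mul_comm, ← mul_assoc, h1, one_mul]
  · have := hT.conjStarAlgAut_star_eigenvectorUnitary
    rw [Unitary.conjStarAlgAut_star_apply] at this
    change ((Uᴴ * T * U) i i).re = _
    have h3 : Uᴴ * T * U = diagonal (RCLike.ofReal ∘ hT.eigenvalues) := this
    simp [h3]

lemma vonNeumannEntropy_eq {n : ℕ} {ρ : QOp n} (h : ρ.IsHermitian) :
    vonNeumannEntropy ρ = ∑ i, Real.negMulLog (h.eigenvalues i) := dif_pos h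

/-- Positivity is stable under convex combinations. -/
lemma posSemidef_sum_ofReal_smul {n : ℕ} {ι : Type*} [Fintype ι] {p : ι → ℝ} (hp : ∀ i, 0 ≤ p i)
    {A : ι → QOp n} (hA : ∀ i, (A i).PosSemidef) : (∑ i, (p i : ℂ) • A i).PosSemidef :=
  Matrix.posSemidef_sum _ fun i _ => (hA i).smul (by exact_mod_cast hp i)

/-- Density matrices form a convex set. -/
lemma IsDensity.sum {n : ℕ} {ι : Type*} [Fintype ι] {p : ι → ℝ} (hp : ∀ i, 0 ≤ p i)
    (hp1 : ∑ i, p i = 1) {A : ι → QOp n} (hA : ∀ i, IsDensity (A i)) :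
    IsDensity (∑ i, (p i : ℂ) • A i) := by
  refine ⟨posSemidef_sum_ofReal_smul hp fun i => (hA i).posSemidef, ?_⟩
  rw [Matrix.trace_sum]
  simp only [Matrix.trace_smul, (hA _).trace_eq_one, smul_eq_mul, mul_one]
  exact_mod_cast hp1

/-- The entropy does not decrease, on average, under a random choice of positive unital
trace-preserving maps. -/
theorem sum_entropy_le_entropy_sum_map {n : ℕ} {ι : Type*} [Fintype ι] {p : ι → ℝ}
    (hp : ∀ k, 0 ≤ p k) (hp1 : ∑ k, p k = 1) {E : ι → QMap n} (hE : ∀ k, IsUnitalPositive (E k))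
    {σ : ι → QOp n} (hσ : ∀ k, (σ k).PosSemidef) :
    ∑ k, p k * vonNeumannEntropy (σ k) ≤ vonNeumannEntropy (∑ k, (p k : ℂ) • E k (σ k)) := by
  have hT : (∑ k, (p k : ℂ) • E k (σ k)).IsHermitian :=
    (posSemidef_sum_ofReal_smul hp fun k => (hE k).map_posSemidef _ (hσ k)).isHermitian
  rw [vonNeumannEntropy_eq hT]
  obtain ⟨d, d_nonneg, d_one, d_sum, d_eig⟩ := hT.exists_eigenbasis_functionals
  choose G G_pos G_tr G_sum G_eig using fun k => (hσ k).isHermitian.exists_spectral_projections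
  set μ := fun k => (hσ k).isHermitian.eigenvalues with hμ
  have hμ0 : ∀ k j, 0 ≤ μ k j := fun k j => (hσ k).eigenvalues_nonneg j
  have D_nonneg : ∀ i k j, 0 ≤ d i (E k (G k j)) := fun i k j =>
    d_nonneg _ _ ((hE k).map_posSemidef _ (G_pos k j))
  -- For each k these weights form a doubly stochastic matrix: unitality fixes the row sums, trace
  -- preservation the column sums. Rows make Jensen applicable; columns collapse the final sum over
  -- i.
  have D_row : ∀ i k, ∑ j, d i (E k (G k j)) = 1 := fun i k => by
    rw [← map_sum, ← map_sum, G_sum, (hE k).map_one, d_one]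
  have D_col : ∀ k j, ∑ i, d i (E k (G k j)) = 1 := fun k j => by
    rw [d_sum, (hE k).map_trace, G_tr, Complex.one_re]
  have eig : ∀ i, hT.eigenvalues i = ∑ x : ι × Fin n, (p x.1 * d i (E x.1 (G x.1 x.2))) • μ x.1 x.2 := by
    intro i
    rw [← d_eig, map_sum, Fintype.sum_prod_type]
    refine Finset.sum_congr rfl fun k _ => ?_
    rw [Complex.coe_smul, map_smul]
    conv_lhs => rw [G_eig k]
    rw [map_sum, map_sum, Finset.smul_sum]
    refine Finset.sum_congr rfl fun j _ => ?_
    rw [LinearMap.map_smul_of_tower, map_smul]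
    simp only [smul_eq_mul, hμ]
    ring
  have jensen : ∀ i, ∑ x : ι × Fin n, (p x.1 * d i (E x.1 (G x.1 x.2))) •
      Real.negMulLog (μ x.1 x.2) ≤ Real.negMulLog (hT.eigenvalues i) := by
    intro i
    rw [eig]
    refine Real.concaveOn_negMulLog.le_map_sum (fun x _ => mul_nonneg (hp _) (D_nonneg _ _ _)) ?_
      fun x _ => hμ0 _ _
    rw [Fintype.sum_prod_type]
    simp only [← Finset.mul_sum, D_row, mul_one, hp1]
  refine le_trans (le_of_eq ?_) (Finset.sum_le_sum fun i _ => jensen i)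
  rw [Finset.sum_comm, Fintype.sum_prod_type]
  refine Finset.sum_congr rfl fun k _ => ?_
  rw [vonNeumannEntropy_eq (hσ k).isHermitian, Finset.mul_sum]
  refine Finset.sum_congr rfl fun j _ => ?_
  simp only [smul_eq_mul]
  rw [← Finset.sum_mul, ← Finset.mul_sum, D_col, mul_one]

theorem entropy_le_entropy_map {n : ℕ} {E : QMap n} (hE : IsUnitalPositive E) {σ : QOp n}
    (hσ : σ.PosSemidef) : vonNeumannEntropy σ ≤ vonNeumannEntropy (E σ) := by
  simpa using sum_entropy_le_entropy_sum_map (ι := Unit) (p := fun _ => 1) (fun _ => zero_le_one)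
    (by simp) (fun _ => hE) (fun _ => hσ)

/-! ### The maximally mixed state and the free channel -/

lemma isUnitalPositive_freeChannel (n : ℕ) [NeZero n] : IsUnitalPositive (freeChannel n) := by
  have hn : (n : ℂ) ≠ 0 := Nat.cast_ne_zero.2 (NeZero.ne n)
  refine ⟨fun X hX => ?_, fun X => ?_, ?_⟩
  · refine (Matrix.PosSemidef.one.smul ?_).smul hX.trace_nonneg
    exact inv_nonneg.2 (Nat.cast_nonneg n)
  · simp [freeChannel, hn]
  · simp [freeChannel, hn]

lemma isDensity_maximallyMixed (n : ℕ) [NeZero n] : IsDensity ((n : ℂ)⁻¹ • (1 : QOp n)) := by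
  have hn : (n : ℂ) ≠ 0 := Nat.cast_ne_zero.2 (NeZero.ne n)
  exact ⟨Matrix.PosSemidef.one.smul (inv_nonneg.2 (Nat.cast_nonneg n)), by simp [hn]⟩

lemma freeChannel_of_isDensity {n : ℕ} {ρ : QOp n} (hρ : IsDensity ρ) :
    freeChannel n ρ = (n : ℂ)⁻¹ • (1 : QOp n) := by
  simp [freeChannel, hρ.trace_eq_one]

/-- The maximally mixed state has the largest entropy. -/
lemma entropy_le_maximallyMixed {n : ℕ} [NeZero n] {ρ : QOp n} (hρ : IsDensity ρ) :
    vonNeumannEntropy ρ ≤ vonNeumannEntropy ((n : ℂ)⁻¹ • (1 : QOp n)) := by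
  rw [← freeChannel_of_isDensity hρ]
  exact entropy_le_entropy_map (isUnitalPositive_freeChannel n) hρ.posSemidef

theorem holevoCapacity_freeChannel (n : ℕ) [NeZero n] : holevoCapacity (freeChannel n) = 0 := by
  -- Over an empty family the supremum would be `⊥`, not 0.
  have : Nonempty (QEnsemble n) :=
    ⟨⟨1, fun _ => 1, fun _ => (n : ℂ)⁻¹ • 1, fun _ => zero_le_one, by simp,
      fun _ => isDensity_maximallyMixed n⟩⟩
  have h : ∀ e : QEnsemble n, holevoQuantity (freeChannel n) e = 0 := fun e => by
    have h1 : ∑ i, (e.prob i : ℂ) = 1 := by exact_mod_cast e.prob_sum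
    simp only [holevoQuantity, freeChannel_of_isDensity (e.state_isDensity _)]
    rw [← Finset.sum_smul, ← Finset.sum_mul, h1, e.prob_sum, one_smul, one_mul, sub_self]
  simp [holevoCapacity, h]

/-! ### Monotonicity from the entropy defect bound -/

/-- Holevo quantities of ensembles indexed by any finite type are bounded by the capacity. -/
lemma holevoQuantity_le_holevoCapacity {n : ℕ} (N : QMap n) {ι : Type*} [Fintype ι] {p : ι → ℝ}
    (hp : ∀ k, 0 ≤ p k) (hp1 : ∑ k, p k = 1) {σ : ι → QOp n} (hσ : ∀ k, IsDensity (σ k)) :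
    ((vonNeumannEntropy (∑ k, (p k : ℂ) • N (σ k)) -
      ∑ k, p k * vonNeumannEntropy (N (σ k)) : ℝ) : EReal) ≤ holevoCapacity N := by
  let f := (Fintype.equivFin ι).symm
  let e : QEnsemble n := ⟨Fintype.card ι, p ∘ f, σ ∘ f, fun i => hp _,
    by rw [← hp1]; exact f.sum_comp p, fun i => hσ _⟩
  refine le_of_eq_of_le ?_ (le_iSup (fun e => (holevoQuantity N e : EReal)) e)
  rw [holevoQuantity]
  congr 2
  · rw [← f.sum_comp]; rfl
  · rw [← f.sum_comp]; rfl

/-- If the capacity of `N` bounds the entropy defect of every output of `N`, then it is not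
increased by unital post-processing and shared randomness. -/
theorem holevoCapacity_superchannel_le {n : ℕ} [NeZero n] {N : QMap n} (hN : IsUnitalPositive N)
    (hsat : ∀ σ, IsDensity σ → ((vonNeumannEntropy ((n : ℂ)⁻¹ • (1 : QOp n)) -
      vonNeumannEntropy (N σ) : ℝ) : EReal) ≤ holevoCapacity N)
    {F : Set (QMap n)} (hF : ∀ E ∈ F, IsUnitalPositive E)
    {S : QMap n →ₗ[ℂ] QMap n} (hS : S ∈ allowedSuperchannels F) :
    holevoCapacity (S N) ≤ holevoCapacity N := by
  obtain ⟨k, q, E, P, hq, hq1, hE, hP, hS⟩ := hS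
  set s := vonNeumannEntropy ((n : ℂ)⁻¹ • (1 : QOp n)) with hs
  refine iSup_le fun e => ?_
  -- No finiteness of the capacity is needed: `⊥` contradicts the real lower bound `hsat`, and `⊤`
  -- is trivial.
  generalize holevoCapacity N = c at hsat ⊢
  induction c with
  | bot => exact absurd (hsat _ (isDensity_maximallyMixed n)) (by simp only [le_bot_iff]; exact EReal.coe_ne_bot _)
  | top => exact le_top
  | coe c =>
    simp only [EReal.coe_le_coe_iff] at hsat ⊢
    have out : ∀ i, S N (e.state i) = ∑ l, (q l : ℂ) • E l (N (P l (e.state i))) := fun i => by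
      rw [hS, LinearMap.sum_apply]; rfl
    have dP : ∀ l i, IsDensity (P l (e.state i)) := fun l i =>
      (hF _ (hP l)).isDensity (e.state_isDensity i)
    have dN : ∀ l i, IsDensity (N (P l (e.state i))) := fun l i => hN.isDensity (dP l i)
    have dS : ∀ i, IsDensity (S N (e.state i)) := fun i => by
      rw [out]
      exact IsDensity.sum hq hq1 fun l => (hF _ (hE l)).isDensity (dN l i)
    have h1 : vonNeumannEntropy (∑ i, (e.prob i : ℂ) • S N (e.state i)) ≤ s :=
      entropy_le_maximallyMixed (IsDensity.sum e.prob_nonneg e.prob_sum dS)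
    -- `hsat` bounds the entropy of each N(P_l(ρ_i)) below by s - c; the random unital
    -- post-processing preserves this bound.
    have h2 : ∀ i, s - c ≤ vonNeumannEntropy (S N (e.state i)) := fun i => by
      rw [out]
      refine le_trans ?_ (sum_entropy_le_entropy_sum_map hq hq1 (fun l => hF _ (hE l))
        fun l => (dN l i).posSemidef)
      calc s - c = ∑ l, q l * (s - c) := by rw [← Finset.sum_mul, hq1, one_mul]
        _ ≤ _ := Finset.sum_le_sum fun l _ => mul_le_mul_of_nonneg_left
          (by linarith [hsat _ (dP l i)]) (hq l)
    have h3 : s - c ≤ ∑ i, e.prob i * vonNeumannEntropy (S N (e.state i)) :=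
      calc s - c = ∑ i, e.prob i * (s - c) := by rw [← Finset.sum_mul, e.prob_sum, one_mul]
        _ ≤ _ := Finset.sum_le_sum fun i _ => mul_le_mul_of_nonneg_left (h2 i) (e.prob_nonneg i)
    rw [holevoQuantity]
    linarith

/-! ### The qubit theory -/

lemma isUnitalPositive_of_mem_mixedUnitaryChannels {n : ℕ} {N : QMap n}
    (hN : N ∈ mixedUnitaryChannels n) : IsUnitalPositive N := by
  obtain ⟨k, p, U, hp, hp1, hU, hN⟩ := hN
  have hpc : ∑ i, (p i : ℂ) = 1 := by exact_mod_cast hp1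
  have h1 : ∀ i, U i * (U i).conjTranspose = 1 := fun i => Matrix.mem_unitaryGroup_iff.mp (hU i)
  have h2 : ∀ i, (U i).conjTranspose * U i = 1 := fun i => Matrix.mem_unitaryGroup_iff'.mp (hU i)
  refine ⟨fun X hX => ?_, fun X => ?_, ?_⟩
  · rw [hN]
    exact posSemidef_sum_ofReal_smul hp fun i => hX.mul_mul_conjTranspose_same _
  · rw [hN, Matrix.trace_sum]
    have : ∀ i, (U i * X * (U i).conjTranspose).trace = X.trace := fun i => by
      rw [Matrix.trace_mul_comm, ← mul_assoc, h2, one_mul]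
    simp only [Matrix.trace_smul, this]
    rw [← Finset.sum_smul, hpc, one_smul]
  · rw [hN]
    simp only [mul_one, h1]
    rw [← Finset.sum_smul, hpc, one_smul]

/-- The qubit map `X ↦ tr(X) 𝟙 - X`. -/
def qubitComplement : QMap 2 where
  toFun X := X.trace • 1 - X
  map_add' X Y := by rw [Matrix.trace_add, add_smul]; abel
  map_smul' c X := by rw [Matrix.trace_smul, smul_assoc, RingHom.id_apply, smul_sub]

lemma qubitComplement_of_isDensity {ρ : QOp 2} (hρ : IsDensity ρ) :
    qubitComplement ρ = 1 - ρ := by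
  simp [qubitComplement, hρ.trace_eq_one]

/-- Positivity holds because this map is transposition followed by conjugation with iσ_y. On the
Bloch ball it is reflection through the centre. -/
lemma isUnitalPositive_qubitComplement : IsUnitalPositive qubitComplement := by
  refine ⟨fun X hX => ?_, fun X => ?_, ?_⟩
  · have h : qubitComplement X =
        !![0, 1; -1, 0] * X.transpose * (!![0, 1; -1, 0] : QOp 2).conjTranspose := by
      ext i j
      fin_cases i <;> fin_cases j <;>
        simp [qubitComplement, Matrix.trace_fin_two, Matrix.vecMul, dotProduct, Matrix.mul_apply,
          Fin.sum_univ_two]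
    rw [h]
    exact hX.transpose.mul_mul_conjTranspose_same _
  · simp [qubitComplement]; ring
  · simp [qubitComplement, Matrix.trace_one, two_smul]

/-- For a unital qubit channel, the equal mixture of a state and its complement has Holevo
quantity equal to the entropy defect of the output. -/
lemma entropy_defect_le_holevoCapacity_qubit {N : QMap 2} (hN : IsUnitalPositive N) {σ : QOp 2}
    (hσ : IsDensity σ) : ((vonNeumannEntropy (((2 : ℕ) : ℂ)⁻¹ • (1 : QOp 2)) -
      vonNeumannEntropy (N σ) : ℝ) : EReal) ≤ holevoCapacity N := by
  have dc : IsDensity (1 - σ) := by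
    rw [← qubitComplement_of_isDensity hσ]
    exact isUnitalPositive_qubitComplement.isDensity hσ
  -- As N is unital, the complement of N(𝟙 - σ) is N(σ), and complementing does not lower entropy.
  have hle : vonNeumannEntropy (N (1 - σ)) ≤ vonNeumannEntropy (N σ) := by
    have h := entropy_le_entropy_map isUnitalPositive_qubitComplement (hN.isDensity dc).posSemidef
    rwa [qubitComplement_of_isDensity (hN.isDensity dc), map_sub, hN.map_one, sub_sub_cancel,
      ← hN.map_one, ← map_sub] at h
  refine le_trans ?_ (holevoQuantity_le_holevoCapacity N (p := fun _ : Fin 2 => 1 / 2)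
    (fun _ => by norm_num) (by simp) (σ := ![σ, 1 - σ]) (by simp [Fin.forall_fin_two, hσ, dc]))
  rw [EReal.coe_le_coe_iff]
  have hsum : ∑ k : Fin 2, (((1 / 2 : ℝ)) : ℂ) • N ((![σ, 1 - σ] : Fin 2 → QOp 2) k) =
      ((2 : ℕ) : ℂ)⁻¹ • (1 : QOp 2) := by
    rw [← Finset.smul_sum, Fin.sum_univ_two, ← map_add]
    simp [hN.map_one]
  rw [hsum]
  simp only [Fin.sum_univ_two, Matrix.cons_val_zero, Matrix.cons_val_one]
  linarith

/-! ### Weyl operators and their twirl -/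

/-- Orthogonality of the characters of `ℤ / n`. -/
lemma sum_rootOfUnity_mul_conj (n : ℕ) [NeZero n] (c d : Fin n) :
    ∑ b : Fin n, Complex.exp (2 * Real.pi * Complex.I / n) ^ (b.val * c.val) *
      star (Complex.exp (2 * Real.pi * Complex.I / n) ^ (b.val * d.val)) =
        if c = d then (n : ℂ) else 0 := by
  set ω := Complex.exp (2 * Real.pi * Complex.I / n) with hω
  have prim : IsPrimitiveRoot ω n := Complex.isPrimitiveRoot_exp n (NeZero.ne n)
  have hn : ω ^ n = 1 := prim.pow_eq_one
  have norm : ω * star ω = 1 := by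
    rw [Complex.star_def, Complex.mul_conj, Complex.normSq_eq_norm_sq,
      prim.norm'_eq_one (NeZero.ne n)]
    simp
  -- ζ is ω^(c - d) without negative exponents, so the sum is geometric with an n-th root of unity
  -- as ratio.
  set ζ := ω ^ c.val * star ω ^ d.val with hζ
  have hsum : ∑ b : Fin n, ω ^ (b.val * c.val) * star (ω ^ (b.val * d.val)) =
      ∑ b ∈ Finset.range n, ζ ^ b := by
    rw [← Fin.sum_univ_eq_sum_range]
    refine Finset.sum_congr rfl fun b _ => ?_
    rw [hζ, mul_pow, star_pow, ← pow_mul, ← pow_mul, mul_comm c.val, mul_comm d.val]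
  rw [hsum]
  split_ifs with h
  · have : ζ = 1 := by rw [hζ, h, ← mul_pow, norm, one_pow]
    simp [this]
  · have hζ1 : ζ ≠ 1 := by
      intro h1
      apply h
      apply Fin.ext
      refine prim.pow_inj c.isLt d.isLt ?_
      calc ω ^ c.val = ω ^ c.val * (ω * star ω) ^ d.val := by rw [norm, one_pow, mul_one]
        _ = ζ * ω ^ d.val := by rw [hζ, mul_pow]; ring
        _ = ω ^ d.val := by rw [h1, one_mul]
    have hζn : ζ ^ n = 1 := by
      rw [hζ, mul_pow, ← pow_mul, ← pow_mul, mul_comm c.val, mul_comm d.val, pow_mul, pow_mul,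
        ← star_pow, hn]
      simp
    rw [geom_sum_eq hζ1, hζn, sub_self, zero_div]

lemma weylOperator_conj_apply {n : ℕ} [NeZero n] (a b : Fin n) (X : QOp n) (r s : Fin n) :
    (weylOperator a b * X * (weylOperator a b).conjTranspose) r s =
      Complex.exp (2 * Real.pi * Complex.I / n) ^ (b.val * (r - a).val) *
        star (Complex.exp (2 * Real.pi * Complex.I / n) ^ (b.val * (s - a).val)) *
          X (r - a) (s - a) := by
  have key : ∀ r c : Fin n, r = c + a ↔ c = r - a := fun r c => by
    rw [eq_sub_iff_add_eq, eq_comm]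
  simp only [Matrix.mul_apply, weylOperator, Matrix.of_apply, Matrix.conjTranspose_apply, key,
    apply_ite star, star_zero, ite_mul, zero_mul, mul_ite, mul_zero, Finset.sum_ite_eq',
    Finset.mem_univ, if_true]
  ring

/-- The Weyl twirl is the completely depolarizing map. -/
lemma sum_weylOperator_conj {n : ℕ} [NeZero n] (X : QOp n) :
    ∑ x : Fin n × Fin n, weylOperator x.1 x.2 * X * (weylOperator x.1 x.2).conjTranspose =
      ((n : ℂ) * X.trace) • (1 : QOp n) := by
  ext r s
  rw [Matrix.sum_apply, Fintype.sum_prod_type]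
  simp only [weylOperator_conj_apply]
  simp only [← Finset.sum_mul, sum_rootOfUnity_mul_conj, sub_left_inj, Matrix.smul_apply,
    Matrix.one_apply, smul_eq_mul]
  split_ifs with h
  · subst h
    rw [← Finset.mul_sum, mul_one, Matrix.trace]
    congr 1
    -- As a varies, r - a runs once through all indices, giving the trace.
    exact (Equiv.subLeft r).sum_comp fun i => X i i
  · simp

lemma weylOperator_mul_conjTranspose {n : ℕ} [NeZero n] (a b : Fin n) :
    weylOperator a b * (weylOperator a b).conjTranspose = 1 := by
  have prim := Complex.isPrimitiveRoot_exp n (NeZero.ne n)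
  have h := weylOperator_conj_apply a b 1
  rw [mul_one] at h
  ext r s
  rw [h]
  simp only [Matrix.one_apply, sub_left_inj]
  split_ifs with hrs
  · subst hrs
    rw [mul_one, Complex.star_def, Complex.mul_conj, Complex.normSq_eq_norm_sq, norm_pow,
      prim.norm'_eq_one (NeZero.ne n)]
    simp
  · rw [mul_zero]

lemma weylOperator_mem_unitaryGroup {n : ℕ} [NeZero n] (a b : Fin n) :
    weylOperator a b ∈ Matrix.unitaryGroup (Fin n) ℂ :=
  Matrix.mem_unitaryGroup_iff.2 (weylOperator_mul_conjTranspose a b)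

/-! ### The Weyl-covariant theory -/

/-- Conjugation by a matrix. -/
def conjMap {n : ℕ} (U : QOp n) : QMap n where
  toFun X := U * X * U.conjTranspose
  map_add' X Y := by rw [mul_add, add_mul]
  map_smul' c X := by simp

lemma isUnitalPositive_conjMap {n : ℕ} {U : QOp n} (hU : U ∈ Matrix.unitaryGroup (Fin n) ℂ) :
    IsUnitalPositive (conjMap U) :=
  isUnitalPositive_of_mem_mixedUnitaryChannels
    ⟨1, fun _ => 1, fun _ => U, by simp, by simp, fun _ => hU, fun X => by simp [conjMap]⟩

/-- Conjugation by a unitary does not increase the entropy. -/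
lemma entropy_conj_le {n : ℕ} {U : QOp n} (hU : U ∈ Matrix.unitaryGroup (Fin n) ℂ) {ρ : QOp n}
    (hρ : ρ.PosSemidef) :
    vonNeumannEntropy (U * ρ * U.conjTranspose) ≤ vonNeumannEntropy ρ := by
  have h2 : U.conjTranspose * U = 1 := Matrix.mem_unitaryGroup_iff'.mp hU
  have hU' : U.conjTranspose ∈ Matrix.unitaryGroup (Fin n) ℂ :=
    Matrix.mem_unitaryGroup_iff.2 (by rwa [Matrix.star_eq_conjTranspose,
      Matrix.conjTranspose_conjTranspose])
  have h := entropy_le_entropy_map (isUnitalPositive_conjMap hU')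
    (hρ.mul_mul_conjTranspose_same U)
  have e : conjMap U.conjTranspose (U * ρ * U.conjTranspose) = ρ := by
    change U.conjTranspose * (U * ρ * U.conjTranspose) * U.conjTranspose.conjTranspose = ρ
    rw [Matrix.conjTranspose_conjTranspose, mul_assoc U, ← mul_assoc U.conjTranspose, h2, one_mul,
      mul_assoc, h2, mul_one]
  rwa [e] at h

open scoped MatrixOrder Matrix.Norms.L2Operator CStarAlgebra in
lemma IsQuantumChannel.map_posSemidef {n : ℕ} {N : QMap n} (hN : IsQuantumChannel N) {X : QOp n}
    (hX : X.PosSemidef) : (N X).PosSemidef := by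
  obtain ⟨f, rfl⟩ := hN.completelyPositive
  exact Matrix.nonneg_iff_posSemidef.1 (map_nonneg f hX.nonneg)

/-- Covariance moves the twirl from the input to the output, where it sees only the trace, which N
preserves. -/
lemma sum_map_weylOperator_conj {n : ℕ} [NeZero n] {N : QMap n}
    (hN : N ∈ weylCovariantChannels n) (X : QOp n) :
    ∑ x : Fin n × Fin n, N (weylOperator x.1 x.2 * X * (weylOperator x.1 x.2).conjTranspose) =
      ((n : ℂ) * X.trace) • (1 : QOp n) := by
  simp only [hN.2]
  rw [sum_weylOperator_conj, hN.1.tracePreserving]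

lemma isUnitalPositive_of_mem_weylCovariantChannels {n : ℕ} [NeZero n] {N : QMap n}
    (hN : N ∈ weylCovariantChannels n) : IsUnitalPositive N := by
  refine ⟨fun X hX => hN.1.map_posSemidef hX, hN.1.tracePreserving, ?_⟩
  have hn : (n : ℂ) ≠ 0 := Nat.cast_ne_zero.2 (NeZero.ne n)
  -- Twirling 𝟙 before N gives n² N(𝟙), and after N gives n² 𝟙; cancel n².
  have h := sum_map_weylOperator_conj hN 1
  rw [← map_sum, sum_weylOperator_conj, map_smul] at h
  refine smul_right_injective _ ?_ h
  simpa using hn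

/-- For a Weyl-covariant channel, the uniform ensemble over the Weyl orbit of a state has Holevo
quantity equal to the entropy defect of the output. -/
lemma entropy_defect_le_holevoCapacity_weyl {n : ℕ} [NeZero n] {N : QMap n}
    (hN : N ∈ weylCovariantChannels n) {σ : QOp n} (hσ : IsDensity σ) :
    ((vonNeumannEntropy ((n : ℂ)⁻¹ • (1 : QOp n)) - vonNeumannEntropy (N σ) : ℝ) : EReal) ≤
      holevoCapacity N := by
  have hn : (n : ℂ) ≠ 0 := Nat.cast_ne_zero.2 (NeZero.ne n)
  have hnr : (n : ℝ) ≠ 0 := Nat.cast_ne_zero.2 (NeZero.ne n)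
  -- Uniform weights on the n² Weyl operators.
  have p0 : ∀ _ : Fin n × Fin n, (0 : ℝ) ≤ ((n : ℝ) * n)⁻¹ := fun _ => by positivity
  have p1 : ∑ _x : Fin n × Fin n, ((n : ℝ) * n)⁻¹ = 1 := by
    simp only [Finset.sum_const, Finset.card_univ, Fintype.card_prod, Fintype.card_fin,
      nsmul_eq_mul, Nat.cast_mul]
    field_simp
  have hU : ∀ x : Fin n × Fin n, weylOperator x.1 x.2 ∈ Matrix.unitaryGroup (Fin n) ℂ :=
    fun x => weylOperator_mem_unitaryGroup _ _
  refine le_trans ?_ (holevoQuantity_le_holevoCapacity N p0 p1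
    fun x => (isUnitalPositive_conjMap (hU x)).isDensity hσ)
  rw [EReal.coe_le_coe_iff]
  have hsum : ∑ x : Fin n × Fin n, ((((n : ℝ) * n)⁻¹ : ℝ) : ℂ) •
      N (conjMap (weylOperator x.1 x.2) σ) = (n : ℂ)⁻¹ • (1 : QOp n) := by
    rw [← Finset.smul_sum]
    refine (congrArg _ (sum_map_weylOperator_conj hN σ)).trans ?_
    rw [hσ.trace_eq_one, smul_smul]
    congr 1
    push_cast
    field_simp
  rw [hsum]
  refine sub_le_sub_left ?_ _
  calc ∑ x : Fin n × Fin n, ((n : ℝ) * n)⁻¹ *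
        vonNeumannEntropy (N (conjMap (weylOperator x.1 x.2) σ))
      ≤ ∑ _x : Fin n × Fin n, ((n : ℝ) * n)⁻¹ * vonNeumannEntropy (N σ) := by
        refine Finset.sum_le_sum fun x _ => mul_le_mul_of_nonneg_left ?_ (p0 x)
        have e : N (conjMap (weylOperator x.1 x.2) σ) =
          weylOperator x.1 x.2 * N σ * (weylOperator x.1 x.2).conjTranspose := hN.2 _ _ _
        rw [e]
        exact entropy_conj_le (hU x) (hN.1.map_posSemidef hσ.posSemidef)
    _ = vonNeumannEntropy (N σ) := by rw [← Finset.sum_mul, p1, one_mul]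

theorem mainTheorem6 :
    (holevoCapacity (freeChannel 2) = 0 ∧
      ∀ N ∈ mixedUnitaryChannels 2, ∀ M ∈ mixedUnitaryChannels 2,
        (∃ Pi ∈ allowedSuperchannels (mixedUnitaryChannels 2), M = Pi N) →
          holevoCapacity M ≤ holevoCapacity N) ∧
    ∀ (n : ℕ) [NeZero n],
      holevoCapacity (freeChannel n) = 0 ∧
        ∀ N ∈ weylCovariantChannels n, ∀ M ∈ weylCovariantChannels n,
          (∃ Pi ∈ allowedSuperchannels (weylCovariantChannels n), M = Pi N) →
            holevoCapacity M ≤ holevoCapacity N := by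
  refine ⟨⟨holevoCapacity_freeChannel 2, ?_⟩, fun n _ => ⟨holevoCapacity_freeChannel n, ?_⟩⟩
  · rintro N hN _ - ⟨S, hS, rfl⟩
    have h := isUnitalPositive_of_mem_mixedUnitaryChannels hN
    exact holevoCapacity_superchannel_le h
      (fun σ hσ => entropy_defect_le_holevoCapacity_qubit h hσ)
      (fun E hE => isUnitalPositive_of_mem_mixedUnitaryChannels hE) hS
  · rintro N hN _ - ⟨S, hS, rfl⟩
    exact holevoCapacity_superchannel_le (isUnitalPositive_of_mem_weylCovariantChannels hN)
      (fun σ hσ => entropy_defect_le_holevoCapacity_weyl hN hσ)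
      (fun E hE => isUnitalPositive_of_mem_weylCovariantChannels hE) hS
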